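/- Let $C$ be a normal cone with nonempty interior $\operatorname{int} C$ in a real Banach space $(X,\|\cdot\|)$, that is, $C$ is a closed convex cone with vertex $0$ such that $C\cap(-C)=\{0\}$ and, for the order $x\le y \iff y-x\in C$, there is a constant $M$ with $\|x\|\le M\|y\|$ whenever $0\le x\le y$. Let $\psi\neq 0$ be a continuous linear form on $X$ that is nonnegative on $C$, and let $\Sigma=\{x\in\operatorname{int} C : \psi(x)=1\}$. Hilbert's projective metric is $$d(x,y)=\log \inf\{b\in\mathbb{R} : y\le bx\}-\log\sup\{a\in\mathbb{R} : ax\le y\},\qquad x,y\in\operatorname{int} C.$$ For a bounded linear operator $L:X\to X$, let $r(L)=\lim_{k\to\infty}\|L^k\|^{1/k}=\inf_{k\ge1}\|L^k\|^{1/k}$ be its spectral radius. The operator $L$ satisfies the weak Krein–Rutman condition with respect to $C$ if $L(C)\subset C$ and either $r(L)=0$, or $r:=r(L)>0$ and (i) there is $u\in C\setminus\{0\}$ such that the null space of $r\,\mathrm{Id}-L$ is $\{\lambda u:\lambda\in\mathbb{R}\}$, and (ii) $r\,\mathrm{Id}-L$ is semi-Fredholm (its range is closed, and its kernel is finite dimensional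 or its range has finite codimension). Let $G$ be an open subset of $X$ included in $C$, and let $f:G\to\operatorname{int} C$ be a map such that $d(f(x),f(y))\le d(x,y)$ for all $x,y\in G\cap\Sigma$. Let $v\in G\cap\Sigma$ satisfy $f(v)=v$. Assume that: 1. $f$ is (Fréchet) differentiable at $v$, with derivative $f'_v$; 2. $f'_v$ satisfies the weak Krein–Rutman condition with respect to $C$; 3. if $r(f'_v)>0$ and $u\in C\setminus\{0\}$ satisfies $f'_v(u)=r(f'_v)\,u$, then $\psi(u)>0$; 4. there exists $\delta$ with $0<\delta\le1$ such that $tv\in G$ and $t f(v)\le f(tv)$ for all $t$ with $1-\delta\le t\le1$. Then $v$ is the unique eigenvector of $f$ in $G\cap\Sigma$: for $w\in G\cap\Sigma$, there exists $\lambda>0$ with $f(w)=\lambda w$ if and only if $w=v$. -/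

import Mathlib

noncomputable section

namespace ConeMap

variable {X : Type*} [NormedAddCommGroup X] [NormedSpace ℝ X]

/-- The relation `x ≤ y` induced by the cone `C`: `y - x ∈ C`. -/
def Le (C : ProperCone ℝ X) (x y : X) : Prop := y - x ∈ C

/-- A normal cone. Mathlib's `ProperCone` is a closed convex cone with vertex `0` (containing `0`);
we add that `C ∩ (-C) = {0}`, and that the norm is monotone on `C` up to a constant. -/
structure IsNormalCone (C : ProperCone ℝ X) : Prop where
  pointed : ∀ x ∈ C, -x ∈ C → x = 0
  normal : ∃ M : ℝ, ∀ x y : X, Le C 0 x → Le C x y → ‖x‖ ≤ M * ‖y‖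

/-- Membership in `C* \ {0}`: a nonzero continuous linear form, nonnegative on `C`. -/
def IsNonzeroDual (C : ProperCone ℝ X) (ψ : X →L[ℝ] ℝ) : Prop :=
  ψ ≠ 0 ∧ ∀ x ∈ C, 0 ≤ ψ x

/-- The slice `Σ = {x ∈ int C | ψ x = 1}`. -/
def slice (C : ProperCone ℝ X) (ψ : X →L[ℝ] ℝ) : Set X :=
  {x | x ∈ interior (C : Set X) ∧ ψ x = 1}

/-- `M(y/x) = inf {b | y ≤ b x}`. It is only used for comparable `x, y ∈ C \ {0}` (for instance
for `x, y ∈ int C`), where the set is nonempty and bounded below. -/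
def upperRatio (C : ProperCone ℝ X) (y x : X) : ℝ := sInf {b : ℝ | Le C y (b • x)}

/-- `m(y/x) = sup {a | a x ≤ y}`. It is only used for comparable `x, y ∈ C \ {0}`, where the set
is nonempty and bounded above. -/
def lowerRatio (C : ProperCone ℝ X) (y x : X) : ℝ := sSup {a : ℝ | Le C (a • x) y}

/-- Hilbert's projective metric `d(x, y) = log M(y/x) - log m(y/x)`, for comparable `x, y`. -/
def hilbertDist (C : ProperCone ℝ X) (x y : X) : ℝ :=
  Real.log (upperRatio C y x) - Real.log (lowerRatio C y x)

/-- The spectral radius `r(L) = inf_{k ≥ 1} ‖L ^ k‖ ^ (1 / k) = lim_k ‖L ^ k‖ ^ (1 / k)` of a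
bounded operator on a real Banach space (not the supremum over the real spectrum only). -/
def specRadius (L : X →L[ℝ] X) : ℝ :=
  ⨅ k : ℕ, ‖L ^ (k + 1)‖ ^ (1 / ((k : ℝ) + 1))

/-- Semi-Fredholm operators: the range is closed, and the kernel is finite dimensional or the range
has finite codimension. -/
def IsSemiFredholm (T : X →L[ℝ] X) : Prop :=
  IsClosed (Set.range T) ∧
    (FiniteDimensional ℝ (LinearMap.ker (T : X →ₗ[ℝ] X)) ∨
      FiniteDimensional ℝ (X ⧸ LinearMap.range (T : X →ₗ[ℝ] X)))

/-- The weak Krein-Rutman condition with respect to `C`. -/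
def WeakKreinRutman (C : ProperCone ℝ X) (L : X →L[ℝ] X) : Prop :=
  (∀ x ∈ C, L x ∈ C) ∧
    (specRadius L = 0 ∨
      (0 < specRadius L ∧
        (∃ u ∈ C, u ≠ 0 ∧
          {x : X | (specRadius L • ContinuousLinearMap.id ℝ X - L) x = 0} =
            {x : X | ∃ c : ℝ, x = c • u}) ∧
        IsSemiFredholm (specRadius L • ContinuousLinearMap.id ℝ X - L)))

end ConeMap

end

noncomputable section

namespace ConeMap

open scoped Pointwise

variable {X : Type*} [NormedAddCommGroup X] [NormedSpace ℝ X] {C : ProperCone ℝ X}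

/-! Suppose `w ≠ v` is another eigenvector in the slice. The normalised map `g = f / ψ(f)` is
nonexpansive for Hilbert's metric and fixes both `v` and `w`. Segments being geodesics, a ball about
`v` and a ball about `w` whose radii add up to `d(v, w)` meet within the slice in a nonempty convex
set `B`, which `g` preserves. If the first ball is small, of size `s`, every point of `B` is at norm
distance comparable to `s` from `v`. On `B`, `g` is affine up to `o(s)`, with linear part `T = L -
ψ(L ·) v`, where `L = f'_v`; Cesàro means of an orbit therefore give `y ∈ B` with `(1 - T)(y - v) =
o(s)`. This is absurd if `1 - T` is bounded below on `ker ψ` (`eq_of_eigenvector`).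

That bound (`WeakKreinRutman.exists_norm_le`) starts from `L v ≤ v`, the infinitesimal form of
subhomogeneity. By normality `r(L) ≤ 1`, and the weak Krein-Rutman condition with `ψ u > 0` makes `1
- L` injective with closed range on `ker ψ`. A telescoping argument shows that `v` is not in that
range, so adding the line through `v` preserves injectivity and closedness. -/

theorem Le.refl (x : X) : Le C x x := by
  simp [Le]

theorem Le.trans {x y z : X} (h₁ : Le C x y) (h₂ : Le C y z) : Le C x z := by
  have := C.add_mem h₁ h₂
  rwa [sub_add_sub_comm, add_comm y z, add_sub_add_right_eq_sub] at this

theorem Le.add {x y x' y' : X} (h : Le C x y) (h' : Le C x' y') : Le C (x + x') (y + y') := by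
  have := C.add_mem h h'
  rwa [sub_add_sub_comm] at this

theorem Le.smul {x y : X} (h : Le C x y) {c : ℝ} (hc : 0 ≤ c) : Le C (c • x) (c • y) := by
  have := C.smul_mem h hc
  rwa [smul_sub] at this

theorem Le.smul_right {x : X} (hx : x ∈ C) {a b : ℝ} (hab : a ≤ b) : Le C (a • x) (b • x) := by
  have := C.smul_mem hx (sub_nonneg.2 hab)
  rwa [sub_smul] at this

theorem Le.apply {x y : X} (h : Le C x y) {ψ : X →L[ℝ] ℝ} (hψ : ∀ z ∈ C, 0 ≤ ψ z) :
    ψ x ≤ ψ y := by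
  have := hψ _ h
  rwa [map_sub, sub_nonneg] at this

theorem Le.map {x y : X} (h : Le C x y) {L : X →L[ℝ] X} (hL : ∀ z ∈ C, L z ∈ C) :
    Le C (L x) (L y) := by
  have := hL _ h
  rwa [map_sub] at this

/-! ### Order units and normality -/

/-- An interior point of the cone is an order unit. -/
theorem exists_le_norm_smul {v : X} (hv : v ∈ interior (C : Set X)) :
    ∃ K : ℝ, 0 < K ∧ ∀ x : X, Le C x ((K * ‖x‖) • v) := by
  obtain ⟨ε, hε, hball⟩ := Metric.isOpen_iff.1 isOpen_interior v hv
  refine ⟨2 / ε, by positivity, fun x => ?_⟩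
  rcases eq_or_ne x 0 with rfl | hx
  · simpa using Le.refl (C := C) (0 : X)
  have hx' : 0 < ‖x‖ := norm_pos_iff.2 hx
  have hmem : v - (ε / (2 * ‖x‖)) • x ∈ C := by
    refine interior_subset (hball ?_)
    rw [Metric.mem_ball, dist_eq_norm, sub_sub_cancel_left, norm_neg, norm_smul,
      Real.norm_of_nonneg (by positivity)]
    field_simp
    linarith
  have := C.smul_mem hmem (show 0 ≤ 2 / ε * ‖x‖ by positivity)
  unfold Le
  convert! this using 1
  rw [smul_sub, smul_smul]
  have : 2 / ε * ‖x‖ * (ε / (2 * ‖x‖)) = 1 := by field_simp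
  rw [this, one_smul]

theorem neg_smul_le_of_order_unit {v : X} {K : ℝ} (h : ∀ x : X, Le C x ((K * ‖x‖) • v)) (x : X) :
    Le C (-(K * ‖x‖) • v) x := by
  have := h (-x)
  rw [norm_neg] at this
  unfold Le at *
  convert! this using 1
  module

theorem apply_pos_of_mem_interior {ψ : X →L[ℝ] ℝ} (hψ : IsNonzeroDual C ψ) {v : X}
    (hv : v ∈ interior (C : Set X)) : 0 < ψ v := by
  obtain ⟨K, -, hK⟩ := exists_le_norm_smul hv
  refine (hψ.2 v (interior_subset hv)).lt_of_ne fun h0 => hψ.1 ?_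
  ext x
  have h1 := (hK x).apply hψ.2
  have h2 := (neg_smul_le_of_order_unit hK x).apply hψ.2
  simp only [map_smul, smul_eq_mul, ← h0, mul_zero] at h1 h2
  exact le_antisymm h1 h2

/-- In a normal cone, order intervals `[-t v, t v]` have norm `O(t)`. -/
theorem IsNormalCone.norm_le_of_order_bounds (hC : IsNormalCone C) (v : X) :
    ∃ K : ℝ, 0 < K ∧ ∀ (x : X) (t : ℝ), 0 ≤ t → Le C (-t • v) x → Le C x (t • v) →
      ‖x‖ ≤ K * t := by
  obtain ⟨M, hM⟩ := hC.normal
  refine ⟨(2 * |M| + 1) * ‖v‖ + 1, by positivity, fun x t ht h1 h2 => ?_⟩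
  -- Normality compares positive vectors only, so `[-t v, t v]` is translated to `[0, 2 t v]`.
  have h := hM (x + t • v) ((2 * t) • v)
    (by unfold Le at *; convert! h1 using 1; module)
    (by unfold Le at *; convert! h2 using 1; module)
  rw [norm_smul, Real.norm_of_nonneg (by positivity)] at h
  have h3 : ‖x‖ ≤ ‖x + t • v‖ + t * ‖v‖ := by
    have := norm_sub_le (x + t • v) (t • v)
    rwa [add_sub_cancel_right, norm_smul, Real.norm_of_nonneg ht] at this
  have h4 : M * (2 * t * ‖v‖) ≤ |M| * (2 * t * ‖v‖) := by
    gcongr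
    exact le_abs_self M
  nlinarith

/-! ### Hilbert balls as order inequalities -/

/-- `y` lies between positive multiples of `x` whose quotient is `ρ`, i.e. `M(y/x) ≤ ρ m(y/x)`. -/
def RatioLe (C : ProperCone ℝ X) (ρ : ℝ) (x y : X) : Prop :=
  ∃ a : ℝ, 0 < a ∧ Le C (a • x) y ∧ Le C y ((ρ * a) • x)

theorem RatioLe.symm {ρ : ℝ} (hρ : 0 < ρ) {x y : X} (h : RatioLe C ρ x y) : RatioLe C ρ y x := by
  obtain ⟨a, ha, h1, h2⟩ := h
  refine ⟨(ρ * a)⁻¹, by positivity, ?_, ?_⟩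
  · have := h2.smul (c := (ρ * a)⁻¹) (by positivity)
    rwa [inv_smul_smul₀ (by positivity)] at this
  · have := h1.smul (c := a⁻¹) (by positivity)
    rw [inv_smul_smul₀ ha.ne'] at this
    convert! this using 2
    field_simp

theorem RatioLe.trans {ρ σ : ℝ} (hσ : 0 < σ) {x y z : X} (h : RatioLe C ρ x y)
    (h' : RatioLe C σ y z) : RatioLe C (ρ * σ) x z := by
  obtain ⟨a, ha, h1, h2⟩ := h
  obtain ⟨b, hb, h3, h4⟩ := h'
  refine ⟨b * a, by positivity, ?_, ?_⟩
  · have := (h1.smul hb.le).trans h3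
    rwa [smul_smul] at this
  · have := h4.trans (h2.smul (c := σ * b) (by positivity))
    rw [smul_smul] at this
    convert! this using 2
    ring

theorem RatioLe.smul_right {ρ : ℝ} {x y : X} (h : RatioLe C ρ x y) {c : ℝ} (hc : 0 < c) :
    RatioLe C ρ x (c • y) := by
  obtain ⟨a, ha, h1, h2⟩ := h
  refine ⟨c * a, by positivity, ?_, ?_⟩
  · have := h1.smul hc.le
    rwa [smul_smul] at this
  · have := h2.smul hc.le
    rw [smul_smul] at this
    convert! this using 2
    ring

theorem RatioLe.smul_left {ρ : ℝ} {x y : X} (h : RatioLe C ρ x y) {c : ℝ} (hc : 0 < c) :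
    RatioLe C ρ (c • x) y := by
  obtain ⟨a, ha, h1, h2⟩ := h
  refine ⟨a / c, by positivity, ?_, ?_⟩
  · rwa [smul_smul, div_mul_cancel₀ _ hc.ne']
  · rwa [smul_smul, mul_assoc, div_mul_cancel₀ _ hc.ne']

theorem convex_setOf_ratioLe (ρ : ℝ) (x : X) : Convex ℝ {y | RatioLe C ρ x y} := by
  rw [convex_iff_forall_pos]
  rintro y ⟨a, ha, h1, h2⟩ z ⟨b, hb, h3, h4⟩ s t hs ht -
  refine ⟨s * a + t * b, by positivity, ?_, ?_⟩
  · have := (h1.smul hs.le).add (h3.smul ht.le)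
    convert! this using 1
    module
  · have := (h2.smul hs.le).add (h4.smul ht.le)
    convert! this using 1
    module

theorem bddBelow_upperRatio {ψ : X →L[ℝ] ℝ} (hψ : IsNonzeroDual C ψ) {x y : X}
    (hx : x ∈ interior (C : Set X)) : BddBelow {b : ℝ | Le C y (b • x)} := by
  refine ⟨ψ y / ψ x, fun b hb => ?_⟩
  have h := Le.apply hb hψ.2
  rw [map_smul, smul_eq_mul] at h
  exact (div_le_iff₀ (apply_pos_of_mem_interior hψ hx)).2 h

theorem bddAbove_lowerRatio {ψ : X →L[ℝ] ℝ} (hψ : IsNonzeroDual C ψ) {x y : X}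
    (hx : x ∈ interior (C : Set X)) : BddAbove {a : ℝ | Le C (a • x) y} := by
  refine ⟨ψ y / ψ x, fun a ha => ?_⟩
  have h := Le.apply ha hψ.2
  rw [map_smul, smul_eq_mul] at h
  exact (le_div_iff₀ (apply_pos_of_mem_interior hψ hx)).2 h

theorem le_upperRatio_smul {ψ : X →L[ℝ] ℝ} (hψ : IsNonzeroDual C ψ) {x y : X}
    (hx : x ∈ interior (C : Set X)) : Le C y (upperRatio C y x • x) := by
  have hclosed : IsClosed {b : ℝ | Le C y (b • x)} :=
    C.isClosed.preimage (f := fun b : ℝ => b • x - y) (by fun_prop)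
  obtain ⟨K, -, hK⟩ := exists_le_norm_smul hx
  exact hclosed.csInf_mem ⟨_, hK y⟩ (bddBelow_upperRatio hψ hx)

theorem lowerRatio_smul_le {ψ : X →L[ℝ] ℝ} (hψ : IsNonzeroDual C ψ) {x y : X}
    (hx : x ∈ interior (C : Set X)) : Le C (lowerRatio C y x • x) y := by
  have hclosed : IsClosed {a : ℝ | Le C (a • x) y} :=
    C.isClosed.preimage (f := fun a : ℝ => y - a • x) (by fun_prop)
  obtain ⟨K, -, hK⟩ := exists_le_norm_smul hx
  exact hclosed.csSup_mem ⟨_, neg_smul_le_of_order_unit hK y⟩ (bddAbove_lowerRatio hψ hx)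

theorem upperRatio_le {ψ : X →L[ℝ] ℝ} (hψ : IsNonzeroDual C ψ) {x y : X}
    (hx : x ∈ interior (C : Set X)) {b : ℝ} (h : Le C y (b • x)) : upperRatio C y x ≤ b :=
  csInf_le (bddBelow_upperRatio hψ hx) h

theorem le_lowerRatio {ψ : X →L[ℝ] ℝ} (hψ : IsNonzeroDual C ψ) {x y : X}
    (hx : x ∈ interior (C : Set X)) {a : ℝ} (h : Le C (a • x) y) : a ≤ lowerRatio C y x :=
  le_csSup (bddAbove_lowerRatio hψ hx) h

theorem lowerRatio_le_upperRatio {ψ : X →L[ℝ] ℝ} (hψ : IsNonzeroDual C ψ) {x y : X}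
    (hx : x ∈ interior (C : Set X)) : lowerRatio C y x ≤ upperRatio C y x := by
  have h := ((lowerRatio_smul_le (y := y) hψ hx).trans (le_upperRatio_smul hψ hx)).apply hψ.2
  simp only [map_smul, smul_eq_mul] at h
  exact le_of_mul_le_mul_right h (apply_pos_of_mem_interior hψ hx)

theorem lowerRatio_pos {ψ : X →L[ℝ] ℝ} (hψ : IsNonzeroDual C ψ) {x y : X}
    (hx : x ∈ interior (C : Set X)) (hy : y ∈ interior (C : Set X)) : 0 < lowerRatio C y x := by
  obtain ⟨K, hK, h⟩ := exists_le_norm_smul hy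
  have hx0 : x ≠ 0 := by
    rintro rfl
    simpa using apply_pos_of_mem_interior hψ hx
  have hx' : 0 < ‖x‖ := norm_pos_iff.2 hx0
  have h1 := (h x).smul (c := (K * ‖x‖)⁻¹) (by positivity)
  rw [inv_smul_smul₀ (by positivity)] at h1
  exact lt_of_lt_of_le (by positivity) (le_lowerRatio hψ hx h1)

/-- Hilbert balls in terms of order inequalities. -/
theorem hilbertDist_le_log_iff {ψ : X →L[ℝ] ℝ} (hψ : IsNonzeroDual C ψ) {x y : X}
    (hx : x ∈ interior (C : Set X)) (hy : y ∈ interior (C : Set X)) {ρ : ℝ} (hρ : 0 < ρ) :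
    hilbertDist C x y ≤ Real.log ρ ↔ RatioLe C ρ x y := by
  have hm := lowerRatio_pos hψ hx hy
  have hM := hm.trans_le (lowerRatio_le_upperRatio hψ hx)
  rw [hilbertDist, sub_le_iff_le_add, ← Real.log_mul hρ.ne' hm.ne',
    Real.log_le_log_iff hM (by positivity)]
  constructor
  · intro h
    exact ⟨_, hm, lowerRatio_smul_le hψ hx,
      (le_upperRatio_smul hψ hx).trans (Le.smul_right (interior_subset hx) h)⟩
  · rintro ⟨a, ha, h1, h2⟩
    exact (upperRatio_le hψ hx h2).trans
      (mul_le_mul_of_nonneg_left (le_lowerRatio hψ hx h1) hρ.le)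

/-! ### Positive operators with `L v ≤ v` -/

theorem pow_apply_mem {L : X →L[ℝ] X} (hL : ∀ z ∈ C, L z ∈ C)
    (n : ℕ) {z : X} (hz : z ∈ C) : (L ^ n) z ∈ C := by
  induction n with
  | zero => simpa using hz
  | succ n ih =>
    rw [pow_succ', mul_apply_eq_comp]
    exact hL _ ih

theorem pow_succ_apply_le {L : X →L[ℝ] X} (hL : ∀ z ∈ C, L z ∈ C) {v : X}
    (hLv : Le C (L v) v) (n : ℕ) :
    Le C ((L ^ (n + 1)) v) ((L ^ n) v) := by
  have := hLv.map (L := L ^ n) fun z hz => pow_apply_mem hL n hz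
  rwa [← mul_apply_eq_comp, ← pow_succ] at this

theorem pow_apply_le {L : X →L[ℝ] X} (hL : ∀ z ∈ C, L z ∈ C) {v : X}
    (hLv : Le C (L v) v) (n : ℕ) : Le C ((L ^ n) v) v := by
  induction n with
  | zero => simpa using Le.refl v
  | succ n ih => exact (pow_succ_apply_le hL hLv n).trans ih

/-- The order interval `[-v, v]` is stable under every `L ^ n`, and for a normal cone it is
comparable to the unit ball. -/
theorem exists_norm_pow_le {L : X →L[ℝ] X} (hL : ∀ z ∈ C, L z ∈ C) {v : X}
    (hC : IsNormalCone C) (hv : v ∈ interior (C : Set X))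
    (hLv : Le C (L v) v) : ∃ K : ℝ, 0 < K ∧ ∀ n : ℕ, ‖L ^ n‖ ≤ K := by
  obtain ⟨A, hA, hunit⟩ := exists_le_norm_smul hv
  obtain ⟨B, hB, hnorm⟩ := hC.norm_le_of_order_bounds v
  refine ⟨B * A, by positivity, fun n => ?_⟩
  have hpos : ∀ z ∈ C, (L ^ n) z ∈ C := fun z hz => pow_apply_mem hL n hz
  have upper (x : X) : Le C ((L ^ n) x) ((A * ‖x‖) • v) := by
    have := (hunit x).map hpos
    rw [map_smul] at this
    exact this.trans ((pow_apply_le hL hLv n).smul (by positivity))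
  refine ContinuousLinearMap.opNorm_le_bound _ (by positivity) fun x => ?_
  rw [mul_assoc]
  refine hnorm _ _ (by positivity) ?_ (upper x)
  have := upper (-x)
  rw [norm_neg, map_neg] at this
  unfold Le at *
  convert! this using 1
  module

theorem specRadius_le_one {L : X →L[ℝ] X} (hL : ∀ z ∈ C, L z ∈ C) {v : X}
    (hC : IsNormalCone C) (hv : v ∈ interior (C : Set X))
    (hLv : Le C (L v) v) : specRadius L ≤ 1 := by
  obtain ⟨K, hK, hpow⟩ := exists_norm_pow_le hL hC hv hLv
  have hlim : Filter.Tendsto (fun k : ℕ => K ^ (1 / ((k : ℝ) + 1))) Filter.atTop (nhds 1) := by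
    have := (Real.continuousAt_const_rpow (b := 0) hK.ne').tendsto.comp
      (tendsto_one_div_add_atTop_nhds_zero_nat (𝕜 := ℝ))
    simpa [Function.comp_def] using this
  refine ge_of_tendsto' hlim fun k => ?_
  refine (ciInf_le ⟨0, ?_⟩ k).trans
    (Real.rpow_le_rpow (norm_nonneg _) (hpow (k + 1)) (by positivity))
  rintro _ ⟨j, rfl⟩
  positivity

/-! ### Lower bound for `1 - L` on `ker ψ`, modulo `v` -/

/-- If `L v ≤ v` then `(1 - L) h = c v` with `h` in the kernel of a positive form `ψ`, `ψ v > 0`,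
forces `c ≤ 0`. -/
theorem nonpos_of_sub_apply_eq_smul {L : X →L[ℝ] X} (hL : ∀ z ∈ C, L z ∈ C) {v : X}
    {ψ : X →L[ℝ] ℝ} (hψ : IsNonzeroDual C ψ)
    (hv : v ∈ interior (C : Set X)) (hLv : Le C (L v) v) {h : X} (hh : ψ h = 0) {c : ℝ}
    (hc : h - L h = c • v) : c ≤ 0 := by
  by_contra! hcpos
  obtain ⟨K, hK, hunit⟩ := exists_le_norm_smul hv
  set σ : ℕ → ℝ := fun n => ψ ((L ^ n) v) with hσ
  have hσ0 (n : ℕ) : 0 ≤ σ n := hψ.2 _ (pow_apply_mem hL n (interior_subset hv))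
  have hanti : Antitone σ :=
    antitone_nat_of_succ_le fun n => (pow_succ_apply_le hL hLv n).apply hψ.2
  -- Apply `ψ` to the telescoped identity `h - L ^ n h = c ∑ L ^ j v`.
  have hsum (n : ℕ) : c * ∑ j ∈ Finset.range n, σ j = - ψ ((L ^ n) h) := by
    induction n with
    | zero => simp [hh]
    | succ n ih =>
      have hstep : (L ^ n) h - (L ^ (n + 1)) h = c • (L ^ n) v := by
        rw [pow_succ, mul_apply_eq_comp, ← map_sub, hc, map_smul]
      have := congrArg ψ hstep
      rw [map_sub, map_smul, smul_eq_mul] at this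
      rw [Finset.sum_range_succ, mul_add, ih, ← this]
      ring
  have hbound (n : ℕ) : c * ∑ j ∈ Finset.range n, σ j ≤ K * ‖h‖ * σ n := by
    have := ((neg_smul_le_of_order_unit hunit h).map
      (fun z hz => pow_apply_mem hL n hz)).apply hψ.2
    rw [map_smul, map_smul, smul_eq_mul] at this
    rw [hsum]
    linarith
  obtain ⟨n, hn⟩ := exists_nat_gt (K * ‖h‖ / c)
  rw [div_lt_iff₀ hcpos] at hn
  have hn0 : 0 < n := by
    rcases Nat.eq_zero_or_pos n with rfl | h'
    · have : 0 ≤ K * ‖h‖ := by positivity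
      simp only [Nat.cast_zero, zero_mul] at hn
      linarith
    · exact h'
  -- As `σ` decreases, `c n σ n ≤ K ‖h‖ σ n`; since `σ n > 0`, this contradicts the choice of `n`.
  have h1 : (n : ℝ) * σ n ≤ ∑ j ∈ Finset.range n, σ j := by
    have := Finset.card_nsmul_le_sum (Finset.range n) σ (σ n)
      fun j hj => hanti (Finset.mem_range.1 hj).le
    simpa using this
  have h2 : σ 0 ≤ ∑ j ∈ Finset.range n, σ j :=
    Finset.single_le_sum (fun j _ => hσ0 j) (Finset.mem_range.2 hn0)
  have h3 : 0 < σ 0 := by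
    simpa [hσ] using apply_pos_of_mem_interior hψ hv
  have h4 := hbound n
  have h5 := mul_le_mul_of_nonneg_left h1 hcpos.le
  have h6 : 0 < c * ∑ j ∈ Finset.range n, σ j := mul_pos hcpos (h3.trans_le h2)
  have h7 : 0 < σ n := pos_of_mul_pos_right (h6.trans_le h4) (by positivity)
  have h8 := mul_lt_mul_of_pos_right hn h7
  linarith

theorem eq_zero_of_sub_apply_eq_smul {L : X →L[ℝ] X} (hL : ∀ z ∈ C, L z ∈ C) {v : X}
    {ψ : X →L[ℝ] ℝ} (hψ : IsNonzeroDual C ψ)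
    (hv : v ∈ interior (C : Set X)) (hLv : Le C (L v) v) {h : X} (hh : ψ h = 0) {c : ℝ}
    (hc : h - L h = c • v) : c = 0 := by
  refine le_antisymm (nonpos_of_sub_apply_eq_smul hL hψ hv hLv hh hc) ?_
  rw [← neg_nonpos]
  refine nonpos_of_sub_apply_eq_smul hL hψ hv hLv (h := -h) (by simp [hh]) ?_
  rw [map_neg, neg_smul, ← hc]
  abel

/-- Some power of `L` has norm below `1`, and `1 - L` is a commuting factor of `1 - L ^ (k + 1)`. -/
theorem isUnit_one_sub_of_specRadius_lt_one [CompleteSpace X] {L : X →L[ℝ] X}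
    (h : specRadius L < 1) : IsUnit (1 - L) := by
  obtain ⟨k, hk⟩ := exists_lt_of_ciInf_lt h
  have hk' : ‖L ^ (k + 1)‖ < 1 := by
    by_contra! hge
    exact hk.not_ge (Real.one_le_rpow hge (by positivity))
  have hu := isUnit_one_sub_of_norm_lt_one hk'
  rw [← geom_sum_mul_neg] at hu
  have hcomm : Commute (∑ i ∈ Finset.range (k + 1), L ^ i) (1 - L) := by
    rw [Commute, SemiconjBy, geom_sum_mul_neg, mul_neg_geom_sum]
  exact (hcomm.isUnit_mul_iff.1 hu).2

/-- On `ker ψ`, the operator `1 - L` is injective with closed range, under the weak Krein-Rutman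
condition and a transversality condition for the eigenvectors. -/
theorem WeakKreinRutman.isClosed_map_ker [CompleteSpace X] {L : X →L[ℝ] X} {ψ : X →L[ℝ] ℝ}
    (hWKR : WeakKreinRutman C L) (hr : specRadius L ≤ 1)
    (hpos : ∀ u ∈ C, u ≠ 0 → 0 < specRadius L → L u = specRadius L • u → 0 < ψ u) :
    (∀ h, ψ h = 0 → h - L h = 0 → h = 0) ∧ IsClosed ((fun h => h - L h) '' {h | ψ h = 0}) := by
  have hker : IsClosed {h | ψ h = 0} := isClosed_eq ψ.continuous continuous_const
  rcases hr.lt_or_eq with hlt | heq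
  · obtain ⟨e, he⟩ := isUnit_one_sub_of_specRadius_lt_one hlt
    set E := ContinuousLinearEquiv.unitsEquiv ℝ X e with hE
    have hEx (x : X) : E x = x - L x := by
      change (e : X →L[ℝ] X) x = _
      rw [he]
      simp
    constructor
    · intro h _ h0
      rw [← hEx] at h0
      exact (map_eq_zero_iff E E.injective).1 h0
    · simp_rw [← hEx]
      exact E.toHomeomorph.isClosedMap _ hker
  · obtain ⟨-, h0 | ⟨-, ⟨u, huC, hu0, hu⟩, hcl, -⟩⟩ := hWKR
    · simp [heq] at h0
    rw [heq] at hu hcl hpos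
    have hsub (x : X) : ((1 : ℝ) • ContinuousLinearMap.id ℝ X - L) x = x - L x := by simp
    simp_rw [hsub] at hu
    have hLu : u - L u = 0 := hu.ge ⟨1, (one_smul ℝ u).symm⟩
    have hψu : 0 < ψ u := hpos u huC hu0 one_pos (by rw [one_smul, ← sub_eq_zero.1 hLu])
    constructor
    · intro h hh h0
      obtain ⟨c, rfl⟩ := hu.le h0
      rw [map_smul, smul_eq_mul, mul_eq_zero, or_iff_left hψu.ne'] at hh
      rw [hh, zero_smul]
    · convert! hcl using 1
      ext y
      constructor
      · rintro ⟨h, -, rfl⟩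
        exact ⟨h, hsub h⟩
      · rintro ⟨x, rfl⟩
        -- Since `X = ker ψ ⊕ ℝ u` and `u` is in the kernel of `1 - L`, the image of `ker ψ` is the
        -- whole range.
        refine ⟨x - (ψ x / ψ u) • u, ?_, ?_⟩
        · simp [hψu.ne']
        · rw [hsub]
          dsimp only
          rw [map_sub, map_smul, ← sub_eq_zero.1 hLu]
          abel

/-- The operator `h ↦ h - L h + c v` is bounded below on `ker ψ × ℝ`. -/
theorem WeakKreinRutman.exists_norm_le [CompleteSpace X] {L : X →L[ℝ] X} {ψ : X →L[ℝ] ℝ} {v : X}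
    (hC : IsNormalCone C) (hψ : IsNonzeroDual C ψ) (hv : v ∈ interior (C : Set X))
    (hLv : Le C (L v) v) (hWKR : WeakKreinRutman C L)
    (hpos : ∀ u ∈ C, u ≠ 0 → 0 < specRadius L → L u = specRadius L • u → 0 < ψ u) :
    ∃ K : ℝ, 0 < K ∧ ∀ (h : X) (c : ℝ), ψ h = 0 → ‖h‖ ≤ K * ‖h - L h + c • v‖ := by
  obtain ⟨hinj, hclosed⟩ :=
    hWKR.isClosed_map_ker (specRadius_le_one hWKR.1 hC hv hLv) hpos
  let N : Submodule ℝ X := LinearMap.ker (ψ : X →ₗ[ℝ] ℝ)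
  have hN {x : X} : x ∈ N ↔ ψ x = 0 := Iff.rfl
  have hNclosed : IsClosed (N : Set X) := isClosed_eq ψ.continuous continuous_const
  have : CompleteSpace N := hNclosed.completeSpace_coe
  let P : (N × ℝ) →L[ℝ] X :=
    ((ContinuousLinearMap.id ℝ X - L).comp N.subtypeL).coprod
      (ContinuousLinearMap.toSpanSingleton ℝ v)
  have hP (h : N) (c : ℝ) : P (h, c) = (h - L h : X) + c • v := by simp [P]
  have hPinj : Function.Injective P := by
    rw [injective_iff_map_eq_zero]
    rintro ⟨⟨h, hh⟩, c⟩ h0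
    rw [hP] at h0
    have hc := eq_zero_of_sub_apply_eq_smul hWKR.1 hψ hv hLv (hN.1 hh) (c := -c)
      (by rw [neg_smul]; exact eq_neg_of_add_eq_zero_left h0)
    rw [neg_eq_zero] at hc
    subst hc
    have := hinj h (hN.1 hh) (by simpa using h0)
    subst this
    rfl
  have hPcl : IsClosed (Set.range P) := by
    have hS : IsClosed ((N.map ((ContinuousLinearMap.id ℝ X - L : X →L[ℝ] X) : X →ₗ[ℝ] X) :
        Submodule ℝ X) : Set X) := hclosed
    have := Submodule.isClosed_sup_finiteDimensional _ (Submodule.span ℝ {v}) hS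
    convert! this using 1
    ext y
    rw [SetLike.mem_coe, Submodule.mem_sup]
    constructor
    · rintro ⟨⟨h, c⟩, rfl⟩
      exact ⟨_, ⟨h, h.2, rfl⟩, c • v, Submodule.mem_span_singleton.2 ⟨c, rfl⟩, (hP h c).symm⟩
    · rintro ⟨_, ⟨h, hh, rfl⟩, z, hz, rfl⟩
      obtain ⟨c, rfl⟩ := Submodule.mem_span_singleton.1 hz
      exact ⟨(⟨h, hh⟩, c), hP _ _⟩
  obtain ⟨K, hK⟩ := P.antilipschitz_of_injective_of_isClosed_range hPinj hPcl
  -- The antilipschitz constant may be `0`, hence `K + 1`.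
  refine ⟨K + 1, by positivity, fun h c hh => ?_⟩
  have h1 := hK.le_mul_dist (⟨h, hh⟩, c) 0
  rw [map_zero, dist_zero_right, dist_zero_right, hP] at h1
  have h2 : ‖h‖ ≤ ‖((⟨h, hh⟩, c) : N × ℝ)‖ := norm_fst_le ((⟨h, hh⟩, c) : N × ℝ)
  have h3 := norm_nonneg (h - L h + c • v)
  simp only at h1
  linarith

/-! ### Hilbert's metric against the norm near `v` -/

theorem smul_mem_interior {c : ℝ} (hc : 0 < c) {x : X} (hx : x ∈ interior (C : Set X)) :
    c • x ∈ interior (C : Set X) := by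
  have hmaps : c • (C : Set X) ⊆ (C : Set X) := by
    rintro _ ⟨y, hy, rfl⟩
    exact C.smul_mem hy hc.le
  refine interior_mono hmaps ?_
  rw [interior_smul₀ hc.ne']
  exact Set.smul_mem_smul_set hx

theorem convex_slice (C : ProperCone ℝ X) (ψ : X →L[ℝ] ℝ) : Convex ℝ (slice C ψ) :=
  C.convex.interior.inter (convex_hyperplane (ψ : X →ₗ[ℝ] ℝ).isLinear 1)

theorem IsNormalCone.exists_norm_sub_le {ψ : X →L[ℝ] ℝ} (hC : IsNormalCone C)
    (hψ : IsNonzeroDual C ψ) {v : X} (hv : v ∈ slice C ψ) :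
    ∃ K : ℝ, 0 < K ∧ ∀ (y : X) (ρ : ℝ), ψ y = 1 → 1 ≤ ρ → RatioLe C ρ v y →
      ‖y - v‖ ≤ K * (ρ - 1) := by
  obtain ⟨K, hK, h⟩ := hC.norm_le_of_order_bounds v
  -- Applying `ψ` gives `a ≤ 1 ≤ ρ a`, whence `2 - ρ ≤ a` and `ρ a ≤ ρ`.
  refine ⟨K, hK, fun y ρ hy hρ ⟨a, ha, h1, h2⟩ => h _ _ (sub_nonneg.2 hρ) ?_ ?_⟩
  all_goals
    have h1' := h1.apply hψ.2
    have h2' := h2.apply hψ.2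
    rw [map_smul, hv.2, hy, smul_eq_mul, mul_one] at h1' h2'
    have hvC := interior_subset hv.1
  · have := (Le.smul_right hvC (show 1 - (ρ - 1) ≤ a by nlinarith)).trans h1
    unfold Le at *
    convert! this using 1
    module
  · have := h2.trans (Le.smul_right hvC (show ρ * a ≤ 1 + (ρ - 1) by nlinarith))
    unfold Le at *
    convert! this using 1
    module

theorem exists_ratioLe_of_norm_sub_le {v : X} (hv : v ∈ interior (C : Set X)) :
    ∃ K : ℝ, 0 < K ∧ ∀ y : X, K * ‖y - v‖ ≤ 1 / 2 → RatioLe C (1 + 4 * (K * ‖y - v‖)) v y := by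
  obtain ⟨K, hK, h⟩ := exists_le_norm_smul hv
  refine ⟨K, hK, fun y hy => ?_⟩
  have h1 := neg_smul_le_of_order_unit h (y - v)
  have h2 := h (y - v)
  have h0 : 0 ≤ K * ‖y - v‖ := by positivity
  set κ := K * ‖y - v‖
  -- From `(1 - κ) v ≤ y ≤ (1 + κ) v`; the quotient is at most `1 + 4 κ` because `κ ≤ 1 / 2`.
  refine ⟨1 - κ, by linarith, ?_, ?_⟩
  · unfold Le at *
    convert! h1 using 1
    module
  · have h3 : Le C y ((1 + κ) • v) := by
      unfold Le at *
      convert! h2 using 1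
      module
    exact h3.trans (Le.smul_right (interior_subset hv) (by nlinarith))

/-- Segments are geodesics for Hilbert's metric; quantitative version near the endpoint `v`. -/
theorem IsNormalCone.exists_segment_ratioLe {ψ : X →L[ℝ] ℝ} (hC : IsNormalCone C)
    (hψ : IsNonzeroDual C ψ) {v w : X} (hv : v ∈ slice C ψ) (hw : w ∈ slice C ψ) (hvw : w ≠ v) :
    ∃ D ρ₀ : ℝ, 0 < D ∧ 0 < ρ₀ ∧ (∀ ρ, RatioLe C ρ v w → ρ₀ ≤ ρ) ∧
      ∀ s : ℝ, 0 < s → s ≤ 1 / 2 → ∃ ρ, 1 + D * s ≤ ρ ∧ ρ ≤ 1 + 2 * D * s ∧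
        RatioLe C ρ v ((1 - s) • v + s • w) ∧ RatioLe C (ρ₀ / ρ) w ((1 - s) • v + s • w) := by
  have ha := lowerRatio_pos hψ hv.1 hw.1
  have hab := lowerRatio_le_upperRatio (y := w) hψ hv.1
  have h1 := lowerRatio_smul_le (y := w) hψ hv.1
  have h2 := le_upperRatio_smul (y := w) hψ hv.1
  have hmin : ∀ ρ, RatioLe C ρ v w → upperRatio C w v / lowerRatio C w v ≤ ρ := by
    rintro ρ ⟨c, hc, h3, h4⟩
    have h5 := le_lowerRatio hψ hv.1 h3
    have h6 := upperRatio_le hψ hv.1 h4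
    have hρ : 0 < ρ := pos_of_mul_pos_left ((ha.trans_le hab).trans_le h6) hc.le
    rw [div_le_iff₀ ha]
    exact h6.trans (mul_le_mul_of_nonneg_left h5 hρ.le)
  set a := lowerRatio C w v
  set b := upperRatio C w v
  have hb := ha.trans_le hab
  have ha1 := h1.apply hψ.2
  have hb1 := h2.apply hψ.2
  rw [map_smul, hv.2, hw.2, smul_eq_mul, mul_one] at ha1 hb1
  have hlt : a < b := by
    refine hab.lt_of_ne fun heq => hvw ?_
    rw [← heq] at h2 hb1
    have ha' : a = 1 := le_antisymm ha1 hb1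
    rw [ha', one_smul] at h1 h2
    refine sub_eq_zero.1 (hC.pointed _ h1 ?_)
    rw [neg_sub]
    exact h2
  refine ⟨b - a, b / a, by linarith, by positivity, hmin, fun s hs hs' => ?_⟩
  have hp : 1 / 2 ≤ 1 - s + s * a := by nlinarith
  have hp1 : 1 - s + s * a ≤ 1 := by nlinarith
  have hq : 1 - s + s * b = 1 - s + s * a + (b - a) * s := by ring
  have hDs : 0 < (b - a) * s := mul_pos (by linarith) hs
  have hp0 : 0 < 1 - s + s * a := by linarith
  have hq0 : 0 < 1 - s + s * b := by linarith
  -- With `p = 1 - s + s a` and `q = 1 - s + s b`, the point lies between `p v` and `q v`, and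
  -- between `(q / b) w` and `(p / a) w`: the two quotients multiply to `b / a`. The bounds on `ρ =
  -- q / p` come from `1 / 2 ≤ p ≤ 1`.
  refine ⟨(1 - s + s * b) / (1 - s + s * a), ?_, ?_, ?_, ?_⟩
  · rw [le_div_iff₀ hp0, hq]
    nlinarith
  · rw [div_le_iff₀ hp0, hq]
    nlinarith
  · refine ⟨1 - s + s * a, hp0, ?_, ?_⟩
    · have := (Le.refl (C := C) ((1 - s) • v)).add (h1.smul hs.le)
      convert! this using 1
      module
    · rw [div_mul_cancel₀ _ hp0.ne']
      have := (Le.refl (C := C) ((1 - s) • v)).add (h2.smul hs.le)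
      convert! this using 1
      module
  · have h1' := h1.smul (c := a⁻¹) (by positivity)
    have h2' := h2.smul (c := b⁻¹) (by positivity)
    rw [inv_smul_smul₀ ha.ne'] at h1'
    rw [inv_smul_smul₀ hb.ne'] at h2'
    refine ⟨(1 - s + s * b) / b, by positivity, ?_, ?_⟩
    · have := (h2'.smul (c := 1 - s) (by linarith)).add (Le.refl (C := C) (s • w))
      convert! this using 1
      rw [smul_smul, ← add_smul]
      congr 1
      field_simp
    · have := (h1'.smul (c := 1 - s) (by linarith)).add (Le.refl (C := C) (s • w))
      convert! this using 1
      rw [smul_smul, ← add_smul]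
      congr 1
      generalize 1 - s + s * b = q at hq0
      field_simp

/-! ### Linearisation at `v` and the contradiction -/

/-- Cesàro means of the orbits of a map that is almost affine on a convex invariant set are almost
fixed by the linear part. -/
theorem exists_norm_sub_apply_le_of_mapsTo {B : Set X} (hB : Convex ℝ B) (hBne : B.Nonempty)
    {g : X → X} (hg : Set.MapsTo g B B) (T : X →L[ℝ] X) (v : X) {R η ε : ℝ} (hε : 0 < ε)
    (hR : ∀ y ∈ B, ‖y - v‖ ≤ R) (hη : ∀ y ∈ B, ‖g y - v - T (y - v)‖ ≤ η) :
    ∃ y ∈ B, ‖(y - v) - T (y - v)‖ ≤ η + ε := by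
  obtain ⟨x₀, hx₀⟩ := hBne
  have hx (k : ℕ) : g^[k] x₀ ∈ B := hg.iterate k hx₀
  -- The boundary term of the telescoping sum is at most `2 R`, so its mean is below `ε`.
  obtain ⟨n, hn⟩ := exists_nat_gt (2 * R / ε)
  have hR0 : 0 ≤ R := (norm_nonneg _).trans (hR _ hx₀)
  have hn0 : (0 : ℝ) < n := lt_of_le_of_lt (by positivity) hn
  rw [div_lt_iff₀ hε] at hn
  refine ⟨∑ k ∈ Finset.range n, (n : ℝ)⁻¹ • g^[k] x₀,
    hB.sum_mem (fun _ _ => by positivity) ?_ fun k _ => hx k, ?_⟩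
  · rw [Finset.sum_const, Finset.card_range, nsmul_eq_mul, mul_inv_cancel₀ hn0.ne']
  have hmean : ∑ k ∈ Finset.range n, (n : ℝ)⁻¹ • g^[k] x₀ - v =
      (n : ℝ)⁻¹ • ∑ k ∈ Finset.range n, (g^[k] x₀ - v) := by
    rw [Finset.sum_sub_distrib, Finset.sum_const, Finset.card_range, smul_sub, Finset.smul_sum,
      ← Nat.cast_smul_eq_nsmul ℝ, inv_smul_smul₀ hn0.ne']
  have htel : ∑ k ∈ Finset.range n, (g^[k] x₀ - v) - T (∑ k ∈ Finset.range n, (g^[k] x₀ - v)) =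
      ((x₀ - v) - (g^[n] x₀ - v)) +
        ∑ k ∈ Finset.range n, (g (g^[k] x₀) - v - T (g^[k] x₀ - v)) := by
    have := Finset.sum_range_sub (fun k => g^[k] x₀) n
    simp only [Function.iterate_succ_apply', Function.iterate_zero, id_eq] at this
    rw [map_sum, Finset.sum_sub_distrib (f := fun k => g (g^[k] x₀) - v),
      sub_sub_sub_cancel_right, ← neg_sub (g^[n] x₀), ← this, ← add_sub_assoc, sub_left_inj,
      ← Finset.sum_neg_distrib, ← Finset.sum_add_distrib]
    refine Finset.sum_congr rfl fun k _ => ?_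
    abel
  rw [hmean, map_smul, ← smul_sub, htel, norm_smul, Real.norm_of_nonneg (by positivity),
    inv_mul_le_iff₀ hn0]
  have hsum := norm_sum_le_of_le (Finset.range n) fun k _ => hη _ (hx k)
  rw [Finset.sum_const, Finset.card_range, nsmul_eq_mul] at hsum
  have h1 := norm_add_le ((x₀ - v) - (g^[n] x₀ - v))
    (∑ k ∈ Finset.range n, (g (g^[k] x₀) - v - T (g^[k] x₀ - v)))
  have h2 := norm_sub_le (x₀ - v) (g^[n] x₀ - v)
  have h3 := hR _ hx₀
  have h4 := hR _ (hx n)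
  linarith

/-- A map which is subhomogeneous along the ray through its fixed point `v` has `f'_v v ≤ v`. -/
theorem fderiv_apply_le_self {f : X → X} {L : X →L[ℝ] X} {v : X} (hf : HasFDerivAt f L v)
    (hfv : f v = v) {δ : ℝ} (hδ : 0 < δ)
    (hsub : ∀ t : ℝ, 1 - δ ≤ t → t ≤ 1 → Le C (t • f v) (f (t • v))) : Le C (L v) v := by
  -- For small `τ > 0`, `v + (f ((1 - τ) v) - v) / τ` is in `C`; its limit is `v - L v`.
  have hline : HasDerivAt (fun τ : ℝ => (1 - τ) • v) (-v) 0 := by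
    have := ((hasDerivAt_id (0 : ℝ)).const_sub 1).smul_const v
    simpa using this
  have hcomp : HasDerivAt (fun τ : ℝ => f ((1 - τ) • v)) (L (-v)) 0 := by
    refine HasFDerivAt.comp_hasDerivAt (0 : ℝ) (l := f) ?_ hline
    simpa using hf
  have hlim := hcomp.tendsto_slope_zero_right.const_add v
  have hmem := C.isClosed.mem_of_tendsto hlim ?_
  · rw [map_neg, ← sub_eq_add_neg] at hmem
    exact hmem
  · filter_upwards [Ioo_mem_nhdsGT hδ] with τ hτ
    have h := hsub (1 - τ) (by linarith [hτ.2]) (by linarith [hτ.1])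
    have := C.smul_mem h (inv_nonneg.2 hτ.1.le)
    simp only [zero_add, sub_zero, one_smul, SetLike.mem_coe]
    convert! this using 1
    have hv : v = τ⁻¹ • τ • v := (inv_smul_smul₀ hτ.1.ne' v).symm
    nth_rewrite 1 [hv]
    rw [← smul_add, hfv]
    congr 1
    module

theorem hasFDerivAt_normalize {f : X → X} {L : X →L[ℝ] X} {v : X} (hf : HasFDerivAt f L v)
    (hfv : f v = v) {ψ : X →L[ℝ] ℝ} (hψ : ψ v = 1) :
    HasFDerivAt (fun x => (ψ (f x))⁻¹ • f x)
      (L - ((ψ.comp L).smulRight v : X →L[ℝ] X)) v := by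
  have h1 : HasFDerivAt (fun x => ψ (f x)) (ψ.comp L) v := ψ.hasFDerivAt.comp v hf
  have h2 := (hasDerivAt_inv (x := ψ (f v)) (by simp [hfv, hψ])).comp_hasFDerivAt v h1
  refine (h2.smul hf).congr_fderiv ?_
  ext x
  simp [hfv, hψ, sub_eq_add_neg]

/-- A differentiable nonexpansive map `f` with fixed point `v` in the slice has no other
eigenvector in the slice as soon as `h ↦ h - L h + ψ (L h) v` is bounded below on `ker ψ`. -/
theorem eq_of_eigenvector {ψ : X →L[ℝ] ℝ} (hC : IsNormalCone C) (hψ : IsNonzeroDual C ψ)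
    {G : Set X} (hG : IsOpen G) {f : X → X} (hf : Set.MapsTo f G (interior (C : Set X)))
    (hnonexp : ∀ x ∈ G ∩ slice C ψ, ∀ y ∈ G ∩ slice C ψ,
      hilbertDist C (f x) (f y) ≤ hilbertDist C x y)
    {v : X} (hv : v ∈ G ∩ slice C ψ) (hfv : f v = v) {L : X →L[ℝ] X} (hL : HasFDerivAt f L v)
    {K : ℝ} (hK : 0 < K)
    (hbelow : ∀ h : X, ψ h = 0 → ‖h‖ ≤ K * ‖h - L h + ψ (L h) • v‖)
    {w : X} (hw : w ∈ G ∩ slice C ψ) {c : ℝ} (hc : 0 < c) (hfw : f w = c • w) : w = v := by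
  by_contra hne
  obtain ⟨D, ρ₀, hD, hρ₀, hmin, hseg⟩ := hC.exists_segment_ratioLe hψ hv.2 hw.2 hne
  obtain ⟨K₁, hK₁, hupper⟩ := hC.exists_norm_sub_le hψ hv.2
  obtain ⟨K₂, hK₂, hlower⟩ := exists_ratioLe_of_norm_sub_le hv.2.1
  set T : X →L[ℝ] X := L - (ψ.comp L).smulRight v with hT
  set g : X → X := fun x => (ψ (f x))⁻¹ • f x with hg
  have hgT : HasFDerivAt g T v := hasFDerivAt_normalize hL hfv hv.2.2
  have hgv : g v = v := by simp [hg, hfv, hv.2.2]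
  -- Chosen so that the final estimate reads `D s ≤ (3 / 8) D s`.
  set η : ℝ := 1 / (32 * K₁ * K₂ * K) with hη
  have hη0 : 0 < η := by positivity
  obtain ⟨δ, hδ, hball⟩ : ∃ δ > 0, ∀ y ∈ Metric.ball v δ,
      y ∈ G ∧ ‖g y - v - T (y - v)‖ ≤ η * ‖y - v‖ := by
    refine Metric.eventually_nhds_iff_ball.1 ((hG.eventually_mem hv.1).and ?_)
    have := (hasFDerivAt_iff_isLittleO.1 hgT).def hη0
    rwa [hgv] at this
  -- The second bound puts `B` in the ball where `g` is nearly affine; the third lets `hlower` apply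
  -- on `B`.
  obtain ⟨s, hs, hs'⟩ : ∃ s : ℝ, 0 < s ∧
      s < min (1 / 2) (min (δ / (2 * K₁ * D)) (1 / (4 * K₁ * K₂ * D))) :=
    exists_between (by positivity)
  obtain ⟨hs2, hsδ, hsK⟩ := by simpa only [lt_min_iff] using hs'
  rw [lt_div_iff₀ (by positivity)] at hsδ hsK
  obtain ⟨ρ, hρ1, hρ2, hvx, hwx⟩ := hseg s hs hs2.le
  have hDs : 0 < D * s := by positivity
  have hρ : 1 ≤ ρ := by linarith
  have hρ0 : 0 < ρ := by linarith
  set B : Set X := slice C ψ ∩ ({y | RatioLe C ρ v y} ∩ {y | RatioLe C (ρ₀ / ρ) w y})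
  have hB : Convex ℝ B :=
    (convex_slice C ψ).inter ((convex_setOf_ratioLe ρ v).inter (convex_setOf_ratioLe _ w))
  have hx : (1 - s) • v + s • w ∈ B :=
    ⟨convex_slice C ψ hv.2 hw.2 (by linarith) hs.le (by ring), hvx, hwx⟩
  have hR : ∀ y ∈ B, ‖y - v‖ ≤ 2 * K₁ * D * s := by
    intro y hy
    refine (hupper y ρ hy.1.2 hρ hy.2.1).trans ?_
    nlinarith
  have hnear : ∀ y ∈ B, y ∈ Metric.ball v δ := by
    intro y hy
    rw [Metric.mem_ball, dist_eq_norm]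
    have := hR y hy
    linarith
  have hmaps : Set.MapsTo g B B := by
    intro y hy
    have hyG : y ∈ G ∩ slice C ψ := ⟨(hball y (hnear y hy)).1, hy.1⟩
    have hfy := hf hyG.1
    have hψf := apply_pos_of_mem_interior hψ hfy
    have key {z : X} (hz : z ∈ G ∩ slice C ψ) {σ : ℝ} (hσ : 0 < σ) (h : RatioLe C σ z y) :
        RatioLe C σ (f z) (g y) := by
      refine RatioLe.smul_right ?_ (inv_pos.2 hψf)
      rw [← hilbertDist_le_log_iff hψ (hf hz.1) hfy hσ]
      exact (hnonexp z hz y hyG).trans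
        ((hilbertDist_le_log_iff hψ hz.2.1 hy.1.1 hσ).2 h)
    refine ⟨⟨smul_mem_interior (inv_pos.2 hψf) hfy, by simp [hg, hψf.ne']⟩, ?_, ?_⟩
    · have := key hv hρ0 hy.2.1
      rwa [hfv] at this
    · have := (key hw (by positivity) hy.2.2).smul_left (inv_pos.2 hc)
      rwa [hfw, inv_smul_smul₀ hc.ne'] at this
  -- Going from `v` to `w` through `y`, minimality of `ρ₀` forces `ρ ≤ 1 + 4 K₂ ‖y - v‖`.
  have hfar : ∀ y ∈ B, D * s ≤ 4 * (K₂ * ‖y - v‖) := by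
    intro y hy
    have h1 := hR y hy
    have h2 : K₂ * ‖y - v‖ ≤ 1 / 2 := by
      have := mul_le_mul_of_nonneg_left h1 hK₂.le
      linarith
    have h3 := hmin _ ((hlower y h2).trans (by positivity)
      (RatioLe.symm (by positivity) hy.2.2))
    rw [mul_div_assoc', le_div_iff₀ hρ0, mul_comm, mul_le_mul_iff_left₀ hρ₀] at h3
    linarith
  have hRpos : 0 < 2 * K₁ * D * s := by positivity
  obtain ⟨y, hy, hyT⟩ := exists_norm_sub_apply_le_of_mapsTo hB ⟨_, hx⟩ hmaps T v
    (R := 2 * K₁ * D * s) (η := η * (2 * K₁ * D * s)) (ε := η * (2 * K₁ * D * s) / 2)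
    (by positivity) hR fun y hy => (hball y (hnear y hy)).2.trans
      (mul_le_mul_of_nonneg_left (hR y hy) hη0.le)
  have hψy : ψ (y - v) = 0 := by rw [map_sub, hy.1.2, hv.2.2, sub_self]
  have hb := hbelow _ hψy
  have hTy : y - v - L (y - v) + ψ (L (y - v)) • v = (y - v) - T (y - v) := by
    simp only [hT, sub_apply, ContinuousLinearMap.smulRight_apply,
      ContinuousLinearMap.comp_apply]
    abel
  rw [hTy] at hb
  have h1 := hb.trans (mul_le_mul_of_nonneg_left hyT hK.le)
  have h2 := (hfar y hy).trans
    (mul_le_mul_of_nonneg_left (mul_le_mul_of_nonneg_left h1 hK₂.le) (by norm_num : (0 : ℝ) ≤ 4))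
  have h3 : 4 * (K₂ * (K * (η * (2 * K₁ * D * s) + η * (2 * K₁ * D * s) / 2))) =
      3 / 8 * (D * s) := by
    rw [hη]
    field_simp
    norm_num
  linarith

end ConeMap

end

theorem corollary8p3 {X : Type*} [NormedAddCommGroup X] [NormedSpace ℝ X] [CompleteSpace X]
    (C : ProperCone ℝ X) (hC : ConeMap.IsNormalCone C)
    (hCint : (interior (C : Set X)).Nonempty)
    (ψ : X →L[ℝ] ℝ) (hψ : ConeMap.IsNonzeroDual C ψ)
    (G : Set X) (hGopen : IsOpen G) (hGC : G ⊆ (C : Set X))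
    (f : X → X) (hf : Set.MapsTo f G (interior (C : Set X)))
    (hnonexp : ∀ x ∈ G ∩ ConeMap.slice C ψ, ∀ y ∈ G ∩ ConeMap.slice C ψ,
      ConeMap.hilbertDist C (f x) (f y) ≤ ConeMap.hilbertDist C x y)
    (v : X) (hv : v ∈ G ∩ ConeMap.slice C ψ) (hfv : f v = v)
    (hdiff : DifferentiableAt ℝ f v)
    (hWKR : ConeMap.WeakKreinRutman C (fderiv ℝ f v))
    (hpos : ∀ u ∈ C, u ≠ 0 → 0 < ConeMap.specRadius (fderiv ℝ f v) →
      fderiv ℝ f v u = ConeMap.specRadius (fderiv ℝ f v) • u → 0 < ψ u)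
    (hsub : ∃ δ : ℝ, 0 < δ ∧ δ ≤ 1 ∧ ∀ t : ℝ, 1 - δ ≤ t → t ≤ 1 →
      t • v ∈ G ∧ ConeMap.Le C (t • f v) (f (t • v))) :
    ∀ w ∈ G ∩ ConeMap.slice C ψ, (∃ c : ℝ, 0 < c ∧ f w = c • w) ↔ w = v := by
  intro w hw
  constructor
  · rintro ⟨c, hc, hfw⟩
    obtain ⟨δ, hδ, -, hsub⟩ := hsub
    have hLv : ConeMap.Le C (fderiv ℝ f v v) v :=
      ConeMap.fderiv_apply_le_self hdiff.hasFDerivAt hfv hδ fun t h1 h2 => (hsub t h1 h2).2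
    obtain ⟨K, hK, hbelow⟩ := hWKR.exists_norm_le hC hψ hv.2.1 hLv hpos
    -- The lower bound is uniform in the coefficient of `v`, here `ψ (L h)`.
    exact ConeMap.eq_of_eigenvector hC hψ hGopen hf hnonexp hv hfv hdiff.hasFDerivAt hK
      (fun h hh => hbelow h _ hh) hw hc hfw
  · rintro rfl
    exact ⟨1, one_pos, by rw [hfv, one_smul]⟩
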